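/- Let $n\ge 1$ and $d\ge 1$ be integers, let $q>0$ and $k>d$ be real numbers. Let $X=(X_1,\ldots,X_n)$ be a random vector with the Dirichlet distribution $\mathcal{D}(q,\ldots,q)$, and let $\Theta_1,\ldots,\Theta_n$ be independent random vectors, independent of $X$, each uniformly distributed on the unit sphere of the Euclidean space $E_d$ of dimension $d$. Put $W_{n,d}=X_1\Theta_1+\cdots+X_n\Theta_n$. A random vector $U$ with values in the closed unit ball of $E_d$, whose law is invariant under all linear isometries of $E_d$, is called hyperuniform of type $k>d$ if $\|U\|^2$ follows the beta distribution $\beta\left(\frac d2,\frac{k-d}2\right)$. If $W_{n,d}$ is hyperuniform of type $k$, then 1. either $d\ge 2$, $q=d-1$, $n\ge 2$ and $k=n(d-1)+1$; 2. or $d\ge 3$, $q=\frac d2-1$, $n\ge 2$ and $k=n(d-2)+2$. -/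

import Mathlib

open MeasureTheory ProbabilityTheory

noncomputable section

/-- The Dirichlet distribution `𝒟(q₁, …, qₙ)` (with all `qᵢ > 0`): the law of
`(Y₁ / S, …, Yₙ / S)` where `Y₁, …, Yₙ` are independent, `Yᵢ` is gamma distributed with shape `qᵢ`
and rate `1`, and `S = Y₁ + ⋯ + Yₙ`. -/
def dirichletMeasure {n : ℕ} (q : Fin n → ℝ) : Measure (Fin n → ℝ) :=
  (Measure.pi fun i => gammaMeasure (q i) 1).map fun y i => y i / ∑ j, y j

/-- The uniform probability distribution on the unit sphere of the `d`-dimensional Euclidean space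
(the normalized surface measure), seen as a measure on the whole space. -/
def sphereUniform (d : ℕ) : Measure (EuclideanSpace ℝ (Fin d)) :=
  (((volume : Measure (EuclideanSpace ℝ (Fin d))).toSphere Set.univ)⁻¹ •
    (volume : Measure (EuclideanSpace ℝ (Fin d))).toSphere).map Subtype.val

/-- The random vector `U` of the `d`-dimensional Euclidean space is hyperuniform of type `k`, where
`k > d` is a real number: `U` takes its values in the closed unit ball (almost surely), its law is
invariant by all the linear isometries of the space, and `‖U‖²` follows the beta distribution with
parameters `d / 2` and `(k - d) / 2`. -/
structure IsHyperuniform {Ω : Type*} [MeasurableSpace Ω] {d : ℕ}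
    (U : Ω → EuclideanSpace ℝ (Fin d)) (k : ℝ) (P : Measure Ω) : Prop where
  lt_type : (d : ℝ) < k
  mem_ball : ∀ᵐ ω ∂P, ‖U ω‖ ≤ 1
  rotation_invariant : ∀ a : EuclideanSpace ℝ (Fin d) ≃ₗᵢ[ℝ] EuclideanSpace ℝ (Fin d),
    IdentDistrib (fun ω => a (U ω)) U P P
  norm_sq_law : HasLaw (fun ω => ‖U ω‖ ^ 2) (betaMeasure ((d : ℝ) / 2) ((k - d) / 2)) P

end

open scoped Pointwise

/-! The second and fourth moments of the norm already force the conclusion. Write `W` for the sum of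
the `X j • Θ j`. Given `X = x`, independence and symmetry on the sphere yield `E‖W‖² = ∑ xᵢ²` and
`E‖W‖⁴ = (1 + 2/d)(∑ xᵢ²)² - (2/d) ∑ xᵢ⁴` (`integral_norm_sq_sum_smul`,
`integral_norm_pow_four_sum_smul`). Averaging over the Dirichlet law needs only its monomial
moments, which are quotients of rising factorials (`integral_monomial_dirichletMeasure`).

Matching with the beta moments `d/k` and `d(d+2)/(k(k+2))` gives two equations. The first is `(q+1)k
= d(nq+1)`; it excludes `n = 1`, where `k = d`, and determines `k`. Substituted in the second, it
leaves `2(n-1)q(d-(q+1))(d-2(q+1)) = 0` (`eq_or_eq_of_moment_identities`). The two roots in `q` are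
the two cases, and `q > 0` bounds `d` from below. -/

theorem Real.Gamma_add_natCast {a : ℝ} (ha : 0 < a) (m : ℕ) :
    Real.Gamma (a + m) = (ascPochhammer ℝ m).eval a * Real.Gamma a := by
  induction m with
  | zero => simp
  | succ m ih =>
    rw [Nat.cast_succ, ← add_assoc, Real.Gamma_add_one (by positivity), ih,
      ascPochhammer_succ_eval]
    ring

/-! ### Gamma distribution: exponentially weighted moments -/

theorem ae_gammaMeasure_pos (a r : ℝ) : ∀ᵐ y ∂gammaMeasure a r, 0 < y := by
  have h : gammaMeasure a r ≪ volume := withDensity_absolutelyContinuous _ _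
  have h0 : ∀ᵐ y ∂gammaMeasure a r, y ≠ 0 := h.ae_le (Measure.ae_ne volume 0)
  have h1 : ∀ᵐ y ∂gammaMeasure a r, 0 ≤ y := by
    rw [gammaMeasure, ae_withDensity_iff (by unfold gammaPDF; fun_prop)]
    filter_upwards with y hy
    by_contra hlt
    exact hy (gammaPDF_of_neg (not_le.1 hlt))
  filter_upwards [h0, h1] with y hy0 hy1 using lt_of_le_of_ne hy1 hy0.symm

/-- The weight turns the density into a multiple of the gamma density of shape `a + m` and rate `1 +
t`. The exponential is kept because negative powers of the sum of the gamma variables are later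
written as Laplace integrals. -/
theorem integral_pow_mul_exp_gammaMeasure {a t : ℝ} (ha : 0 < a) (ht : 0 ≤ t) (m : ℕ) :
    ∫ y, y ^ m * Real.exp (-(t * y)) ∂gammaMeasure a 1 =
      (ascPochhammer ℝ m).eval a * (1 + t) ^ (-(a + m)) := by
  rw [gammaMeasure, integral_withDensity_eq_integral_toReal_smul (by unfold gammaPDF; fun_prop)
    (Filter.Eventually.of_forall fun y => by simp [gammaPDF])]
  have h : ∀ y : ℝ, (gammaPDF a 1 y).toReal • (y ^ m * Real.exp (-(t * y))) =
      (Set.Ici (0 : ℝ)).indicator (fun y => (Real.Gamma a)⁻¹ *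
        (y ^ (a - 1) * y ^ m * Real.exp (-((1 + t) * y)))) y := by
    intro y
    by_cases hy : 0 ≤ y
    · rw [Set.indicator_of_mem (Set.mem_Ici.2 hy), gammaPDF,
        ENNReal.toReal_ofReal (gammaPDFReal_nonneg ha one_pos y), gammaPDFReal, if_pos hy,
        show -((1 + t) * y) = -(1 * y) + -(t * y) by ring, Real.exp_add]
      simp only [Real.one_rpow, smul_eq_mul]
      ring
    · rw [Set.indicator_of_notMem (by simpa using hy), gammaPDF_of_neg (not_le.1 hy)]
      simp
  simp_rw [h]
  rw [integral_indicator measurableSet_Ici, integral_Ici_eq_integral_Ioi, integral_const_mul]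
  have h2 : ∫ y in Set.Ioi (0 : ℝ), y ^ (a - 1) * y ^ m * Real.exp (-((1 + t) * y)) =
      ∫ y in Set.Ioi (0 : ℝ), y ^ (a + m - 1) * Real.exp (-((1 + t) * y)) := by
    refine setIntegral_congr_fun measurableSet_Ioi fun y hy => ?_
    rw [← Real.rpow_natCast y m, ← Real.rpow_add hy]
    congr 2
    ring
  rw [h2, Real.integral_rpow_mul_exp_neg_mul_Ioi (by positivity) (by positivity),
    Real.Gamma_add_natCast ha, one_div, Real.inv_rpow (by positivity), Real.rpow_neg (by positivity)]
  have := (Real.Gamma_pos_of_pos ha).ne'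
  field_simp

theorem integrable_pow_mul_exp_gammaMeasure {a t : ℝ} (ha : 0 < a) (ht : 0 ≤ t) (m : ℕ) :
    Integrable (fun y => y ^ m * Real.exp (-(t * y))) (gammaMeasure a 1) := by
  -- The Bochner integral of a non-integrable function is `0` by convention, so a nonzero value
  -- proves integrability.
  apply Integrable.of_integral_ne_zero
  rw [integral_pow_mul_exp_gammaMeasure ha ht]
  have := ascPochhammer_pos m a ha
  positivity

/-! ### Monomial moments of the Dirichlet distribution -/

section Dirichlet

variable {n : ℕ} {q : Fin n → ℝ}

theorem isProbabilityMeasure_gammaMeasure_one (hq : ∀ i, 0 < q i) (i : Fin n) :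
    IsProbabilityMeasure (gammaMeasure (q i) 1) :=
  isProbabilityMeasure_gammaMeasure (hq i) one_pos

theorem measurable_div_sum : Measurable fun (y : Fin n → ℝ) i => y i / ∑ j, y j := by
  fun_prop

theorem ae_pi_gammaMeasure_pos (hq : ∀ i, 0 < q i) :
    ∀ᵐ y ∂Measure.pi fun i => gammaMeasure (q i) 1, ∀ i, 0 < y i := by
  have := isProbabilityMeasure_gammaMeasure_one hq
  exact ae_all_iff.2 fun i => Measure.tendsto_eval_ae_ae (ae_gammaMeasure_pos _ _)

theorem isProbabilityMeasure_dirichletMeasure (hq : ∀ i, 0 < q i) :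
    IsProbabilityMeasure (dirichletMeasure q) := by
  have := isProbabilityMeasure_gammaMeasure_one hq
  exact Measure.isProbabilityMeasure_map measurable_div_sum.aemeasurable

theorem ae_dirichletMeasure (hn : 0 < n) (hq : ∀ i, 0 < q i) :
    ∀ᵐ x ∂dirichletMeasure q, (∀ i, 0 ≤ x i) ∧ ∑ i, x i = 1 := by
  rw [dirichletMeasure, ae_map_iff measurable_div_sum.aemeasurable]
  · filter_upwards [ae_pi_gammaMeasure_pos hq] with y hy
    have : 0 < ∑ j, y j := Finset.sum_pos (fun i _ => hy i) ⟨⟨0, hn⟩, Finset.mem_univ _⟩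
    refine ⟨fun i => by have := hy i; positivity, ?_⟩
    rw [← Finset.sum_div, div_self this.ne']
  · measurability

theorem ae_dirichletMeasure_le_one (hn : 0 < n) (hq : ∀ i, 0 < q i) :
    ∀ᵐ x ∂dirichletMeasure q, ∀ i, x i ≤ 1 := by
  filter_upwards [ae_dirichletMeasure hn hq] with x hx i
  rw [← hx.2]
  exact Finset.single_le_sum (fun j _ => hx.1 j) (Finset.mem_univ i)

theorem integrable_monomial_dirichletMeasure (hn : 0 < n) (hq : ∀ i, 0 < q i) (a : Fin n → ℕ) :
    Integrable (fun x => ∏ i, x i ^ a i) (dirichletMeasure q) := by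
  have := isProbabilityMeasure_dirichletMeasure hq
  refine Integrable.of_bound
    (Measurable.aestronglyMeasurable (Finset.measurable_prod _ fun i _ => by fun_prop)) 1 ?_
  filter_upwards [ae_dirichletMeasure hn hq, ae_dirichletMeasure_le_one hn hq] with x hx hx1
  rw [Real.norm_of_nonneg (Finset.prod_nonneg fun i _ => pow_nonneg (hx.1 i) _)]
  exact Finset.prod_le_one (fun i _ => pow_nonneg (hx.1 i) _)
    fun i _ => pow_le_one₀ (hx.1 i) (hx1 i)

/-- The factor by which the moments of order `m` of independent standard gamma variables of total
shape `Q` are multiplied when the variables are divided by their sum. -/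
noncomputable def dirichletMomentFactor (m : ℕ) (Q : ℝ) : ℝ :=
  (∫⁻ t in Set.Ioi (0 : ℝ),
    ENNReal.ofReal (t ^ ((m : ℝ) - 1) / Real.Gamma m * (1 + t) ^ (-(Q + m)))).toReal

theorem lintegral_monomial_mul_exp_gammaMeasure (hq : ∀ i, 0 < q i) (a : Fin n → ℕ) {t : ℝ}
    (ht : 0 ≤ t) :
    ∫⁻ y, ENNReal.ofReal ((∏ i, y i ^ a i) * Real.exp (-(t * ∑ i, y i)))
      ∂Measure.pi (fun i => gammaMeasure (q i) 1) =
    ENNReal.ofReal ((∏ i, (ascPochhammer ℝ (a i)).eval (q i)) *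
      (1 + t) ^ (-((∑ i, q i) + (∑ i, a i : ℕ)))) := by
  have := isProbabilityMeasure_gammaMeasure_one hq
  have h : ∀ y : Fin n → ℝ, (∏ i, y i ^ a i) * Real.exp (-(t * ∑ i, y i)) =
      ∏ i, (y i ^ a i * Real.exp (-(t * y i))) := by
    intro y
    rw [Finset.prod_mul_distrib, ← Real.exp_sum, Finset.mul_sum, Finset.sum_neg_distrib]
  simp_rw [h]
  rw [← ofReal_integral_eq_lintegral_ofReal, integral_fintype_prod_eq_prod
    (f := fun i y => y ^ a i * Real.exp (-(t * y)))]
  · simp_rw [fun i => integral_pow_mul_exp_gammaMeasure (hq i) ht (a i)]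
    rw [Finset.prod_mul_distrib, ← Real.rpow_sum_of_pos (by positivity), Finset.sum_neg_distrib,
      Finset.sum_add_distrib, Nat.cast_sum]
  · exact Integrable.fintype_prod_dep fun i =>
      integrable_pow_mul_exp_gammaMeasure (hq i) ht (a i)
  · filter_upwards [ae_pi_gammaMeasure_pos hq] with y hy
    exact Finset.prod_nonneg fun i _ => by have := hy i; positivity

theorem lintegral_rpow_mul_exp_Ioi {m : ℕ} (hm : 0 < m) {s : ℝ} (hs : 0 < s) :
    ∫⁻ t in Set.Ioi (0 : ℝ),
      ENNReal.ofReal (t ^ ((m : ℝ) - 1) / Real.Gamma m * Real.exp (-(t * s))) =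
    ENNReal.ofReal (s ^ m)⁻¹ := by
  have hm' : (0 : ℝ) < m := by exact_mod_cast hm
  have hG := Real.Gamma_pos_of_pos hm'
  have h : ∫ t in Set.Ioi (0 : ℝ), t ^ ((m : ℝ) - 1) / Real.Gamma m * Real.exp (-(t * s)) =
      (s ^ m)⁻¹ := by
    have h1 : ∀ t : ℝ, t ^ ((m : ℝ) - 1) / Real.Gamma m * Real.exp (-(t * s)) =
        (Real.Gamma m)⁻¹ * (t ^ ((m : ℝ) - 1) * Real.exp (-(s * t))) := by
      intro t
      rw [mul_comm s t]
      ring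
    simp_rw [h1]
    rw [integral_const_mul, Real.integral_rpow_mul_exp_neg_mul_Ioi hm' hs, Real.rpow_natCast]
    rw [inv_mul_eq_div, mul_div_cancel_right₀ _ hG.ne', one_div, inv_pow]
  rw [← ofReal_integral_eq_lintegral_ofReal, h]
  · apply Integrable.of_integral_ne_zero
    rw [h]
    positivity
  · filter_upwards [ae_restrict_mem measurableSet_Ioi] with t ht
    have : (0 : ℝ) < t := ht
    simp only [Pi.zero_apply]
    positivity

/-- Replace `S⁻ᵐ` by `∫ tᵐ⁻¹ e^{-tS} dt / Γ(m)` and exchange the integrals: for fixed `t` the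
integrand is a product over the independent coordinates. What remains in `t` depends only on the
degree and the total shape. Convergence at `0` requires `m > 0`. -/
theorem integral_monomial_dirichletMeasure_eq_mul_factor (hn : 0 < n) (hq : ∀ i, 0 < q i)
    (a : Fin n → ℕ) (ha : 0 < ∑ i, a i) :
    ∫ x, ∏ i, x i ^ a i ∂dirichletMeasure q =
      (∏ i, (ascPochhammer ℝ (a i)).eval (q i)) *
        dirichletMomentFactor (∑ i, a i) (∑ i, q i) := by
  have := isProbabilityMeasure_gammaMeasure_one hq
  set m := ∑ i, a i with hm
  have hP : 0 ≤ ∏ i, (ascPochhammer ℝ (a i)).eval (q i) :=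
    Finset.prod_nonneg fun i _ => (ascPochhammer_pos _ _ (hq i)).le
  have hG : 0 < Real.Gamma m := Real.Gamma_pos_of_pos (by exact_mod_cast ha)
  rw [integral_eq_lintegral_of_nonneg_ae _
    (Measurable.aestronglyMeasurable (Finset.measurable_prod _ fun i _ => by fun_prop)), dirichletMeasure,
    lintegral_map (by fun_prop) measurable_div_sum]
  swap
  · filter_upwards [ae_dirichletMeasure hn hq] with x hx
    exact Finset.prod_nonneg fun i _ => pow_nonneg (hx.1 i) _
  have key : ∫⁻ y : Fin n → ℝ, ENNReal.ofReal (∏ i, (y i / ∑ j, y j) ^ a i)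
        ∂Measure.pi (fun i => gammaMeasure (q i) 1) =
      ∫⁻ y : Fin n → ℝ, (∫⁻ t in Set.Ioi (0 : ℝ),
        ENNReal.ofReal (t ^ ((m : ℝ) - 1) / Real.Gamma m) *
          ENNReal.ofReal ((∏ i, y i ^ a i) * Real.exp (-(t * ∑ i, y i))))
        ∂Measure.pi (fun i => gammaMeasure (q i) 1) := by
    refine lintegral_congr_ae ?_
    filter_upwards [ae_pi_gammaMeasure_pos hq] with y hy
    have hS : 0 < ∑ j, y j := Finset.sum_pos (fun i _ => hy i) ⟨⟨0, hn⟩, Finset.mem_univ _⟩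
    have hy' : 0 ≤ ∏ i, y i ^ a i := Finset.prod_nonneg fun i _ => pow_nonneg (hy i).le _
    simp_rw [div_pow]
    rw [Finset.prod_div_distrib, Finset.prod_pow_eq_pow_sum, div_eq_mul_inv,
      ENNReal.ofReal_mul hy', ← lintegral_rpow_mul_exp_Ioi ha hS,
      ← lintegral_const_mul _ (by fun_prop)]
    refine setLIntegral_congr_fun measurableSet_Ioi fun t ht => ?_
    have ht' : (0 : ℝ) < t := ht
    rw [← ENNReal.ofReal_mul hy', ← ENNReal.ofReal_mul (by positivity)]
    congr 1
    ring
  rw [key, lintegral_lintegral_swap (by fun_prop), dirichletMomentFactor,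
    ← ENNReal.toReal_ofReal hP, ← ENNReal.toReal_mul, ← lintegral_const_mul _ (by fun_prop)]
  congr 1
  refine setLIntegral_congr_fun measurableSet_Ioi fun t ht => ?_
  have ht' : (0 : ℝ) < t := ht
  rw [lintegral_const_mul _ (by fun_prop), lintegral_monomial_mul_exp_gammaMeasure hq a ht'.le,
    ← ENNReal.ofReal_mul (by positivity), ← ENNReal.ofReal_mul hP]
  congr 1
  ring

/-- Multiply the integrand by `∑ xⱼ = 1`. This links degree `m` to degree `m + 1` and spares the
evaluation of the integral in `dirichletMomentFactor`. -/
theorem integral_monomial_dirichletMeasure_eq_sum (hn : 0 < n) (hq : ∀ i, 0 < q i)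
    (a : Fin n → ℕ) :
    ∫ x, ∏ i, x i ^ a i ∂dirichletMeasure q =
      ∑ j, ∫ x, ∏ i, x i ^ (a + Pi.single j 1 : Fin n → ℕ) i ∂dirichletMeasure q := by
  rw [← integral_finsetSum _ fun j _ => integrable_monomial_dirichletMeasure hn hq _]
  refine integral_congr_ae ?_
  filter_upwards [ae_dirichletMeasure hn hq] with x hx
  simp_rw [Pi.add_apply, pow_add, Finset.prod_mul_distrib]
  rw [← Finset.mul_sum]
  simp [Pi.single_apply, pow_ite, hx.2]

theorem prod_ascPochhammer_add_single (a : Fin n → ℕ) (j : Fin n) :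
    ∏ i, (ascPochhammer ℝ ((a + Pi.single j 1 : Fin n → ℕ) i)).eval (q i) =
      (∏ i, (ascPochhammer ℝ (a i)).eval (q i)) * (q j + a j) := by
  rw [← Finset.mul_prod_erase _ _ (Finset.mem_univ j),
    ← Finset.mul_prod_erase _ (fun i => (ascPochhammer ℝ (a i)).eval (q i)) (Finset.mem_univ j)]
  have : ∀ i ∈ Finset.univ.erase j, (ascPochhammer ℝ ((a + Pi.single j 1 : Fin n → ℕ) i)).eval (q i) =
      (ascPochhammer ℝ (a i)).eval (q i) := by
    intro i hi
    simp [Pi.single_eq_of_ne (Finset.ne_of_mem_erase hi)]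
  rw [Finset.prod_congr rfl this]
  simp only [Pi.add_apply, Pi.single_eq_same, ascPochhammer_succ_eval]
  ring

theorem integral_monomial_dirichletMeasure (hn : 0 < n) (hq : ∀ i, 0 < q i) (a : Fin n → ℕ) :
    ∫ x, ∏ i, x i ^ a i ∂dirichletMeasure q =
      (∏ i, (ascPochhammer ℝ (a i)).eval (q i)) /
        (ascPochhammer ℝ (∑ i, a i)).eval (∑ i, q i) := by
  have hQ : 0 < ∑ i, q i := Finset.sum_pos (fun i _ => hq i) ⟨⟨0, hn⟩, Finset.mem_univ _⟩
  have hsum : ∀ (b : Fin n → ℕ) j, ∑ i, (b + Pi.single j 1 : Fin n → ℕ) i = (∑ i, b i) + 1 := by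
    intro b j
    simp [Finset.sum_add_distrib]
  have hrec : ∀ b : Fin n → ℕ, ∫ x, ∏ i, x i ^ b i ∂dirichletMeasure q =
      (∏ i, (ascPochhammer ℝ (b i)).eval (q i)) * ((∑ i, q i) + (∑ i, b i : ℕ)) *
        dirichletMomentFactor ((∑ i, b i) + 1) (∑ i, q i) := by
    intro b
    rw [integral_monomial_dirichletMeasure_eq_sum hn hq]
    simp_rw [fun j => integral_monomial_dirichletMeasure_eq_mul_factor hn hq (b + Pi.single j 1)
      (by rw [hsum]; omega), hsum, prod_ascPochhammer_add_single]
    rw [← Finset.sum_mul, ← Finset.mul_sum, Finset.sum_add_distrib, Nat.cast_sum]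
  -- Total mass one gives the factor in degree `1`; then two expressions for the same moment give
  -- `factor m = (Q + m) * factor (m + 1)`.
  have hfac : ∀ m : ℕ, dirichletMomentFactor (m + 1) (∑ i, q i) =
      ((ascPochhammer ℝ (m + 1)).eval (∑ i, q i))⁻¹ := by
    intro m
    induction m with
    | zero =>
      have := isProbabilityMeasure_dirichletMeasure hq
      have h := hrec 0
      simp at h
      simpa using eq_inv_of_mul_eq_one_right h.symm
    | succ m ih =>
      -- Any exponent of total degree `m + 1` would do.
      let b : Fin n → ℕ := Pi.single ⟨0, hn⟩ (m + 1)
      have hb : ∑ i, b i = m + 1 := by simp [b]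
      have h := hrec b
      rw [integral_monomial_dirichletMeasure_eq_mul_factor hn hq b (by omega), hb, mul_assoc] at h
      have hP : (∏ i, (ascPochhammer ℝ (b i)).eval (q i)) ≠ 0 :=
        Finset.prod_ne_zero_iff.2 fun i _ => (ascPochhammer_pos _ _ (hq i)).ne'
      have h' := mul_left_cancel₀ hP h
      rw [ascPochhammer_succ_eval, mul_inv, ← ih, h', mul_comm, ← mul_assoc,
        inv_mul_cancel₀ (by positivity), one_mul]
  rw [hrec, hfac, ascPochhammer_succ_eval]
  have := ascPochhammer_pos (∑ i, a i) _ hQ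
  field_simp

end Dirichlet

/-! ### Uniform law on the sphere and norms of random sums -/

section Sphere

variable {d : ℕ}

theorem sphereUniform_apply {s : Set (EuclideanSpace ℝ (Fin d))} (hs : MeasurableSet s) :
    sphereUniform d s = ((volume : Measure (EuclideanSpace ℝ (Fin d))).toSphere Set.univ)⁻¹ *
      (d * volume (Set.Ioo (0 : ℝ) 1 • (s ∩ Metric.sphere (0 : EuclideanSpace ℝ (Fin d)) 1))) := by
  rw [sphereUniform, Measure.map_apply measurable_subtype_coe hs, Measure.smul_apply, smul_eq_mul,
    Measure.toSphere_apply' _ (measurable_subtype_coe hs), Subtype.image_preimage_coe,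
    finrank_euclideanSpace_fin, Set.inter_comm]

theorem isProbabilityMeasure_sphereUniform (hd : 0 < d) :
    IsProbabilityMeasure (sphereUniform d) := by
  have : Nonempty (Fin d) := ⟨⟨0, hd⟩⟩
  have : IsProbabilityMeasure
      (((volume : Measure (EuclideanSpace ℝ (Fin d))).toSphere Set.univ)⁻¹ •
        (volume : Measure (EuclideanSpace ℝ (Fin d))).toSphere) := by
    refine ⟨?_⟩
    rw [Measure.smul_apply, smul_eq_mul, ENNReal.inv_mul_cancel]
    · exact fun h => Measure.toSphere_ne_zero _ (Measure.measure_univ_eq_zero.1 h)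
    · exact measure_ne_top _ _
  exact Measure.isProbabilityMeasure_map measurable_subtype_coe.aemeasurable

theorem ae_sphereUniform_norm_eq_one : ∀ᵐ θ ∂sphereUniform d, ‖θ‖ = 1 := by
  rw [sphereUniform, ae_map_iff measurable_subtype_coe.aemeasurable]
  · exact Filter.Eventually.of_forall fun θ => by simp
  · exact measurableSet_eq_fun (by fun_prop) (by fun_prop)

theorem measurePreserving_sphereUniform
    (a : EuclideanSpace ℝ (Fin d) ≃ₗᵢ[ℝ] EuclideanSpace ℝ (Fin d)) :
    MeasurePreserving a (sphereUniform d) (sphereUniform d) := by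
  have ha : Measurable a := a.continuous.measurable
  refine ⟨ha, Measure.ext fun s hs => ?_⟩
  rw [Measure.map_apply ha hs, sphereUniform_apply hs, sphereUniform_apply (ha hs),
    -- The surface measure of a set is `d` times the volume of the cone over it, and isometries
    -- preserve volume and commute with forming cones.
    ← a.measurePreserving.measure_preimage_emb a.toHomeomorph.measurableEmbedding
      (Set.Ioo (0 : ℝ) 1 • (s ∩ Metric.sphere (0 : EuclideanSpace ℝ (Fin d)) 1))]
  congr 3
  ext v
  simp only [Set.mem_smul, Set.mem_inter_iff, Set.mem_preimage, mem_sphere_zero_iff_norm]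
  constructor
  · rintro ⟨r, hr, w, ⟨hw, hw1⟩, rfl⟩
    exact ⟨r, hr, a w, ⟨hw, by simpa using hw1⟩, (map_smul a r w).symm⟩
  · rintro ⟨r, hr, w, ⟨hw, hw1⟩, h⟩
    refine ⟨r, hr, a.symm w, ⟨by simpa using hw, by simpa using hw1⟩, ?_⟩
    rw [← map_smul, h, a.symm_apply_apply]

theorem integral_comp_isometry_sphereUniform
    (a : EuclideanSpace ℝ (Fin d) ≃ₗᵢ[ℝ] EuclideanSpace ℝ (Fin d))
    (f : EuclideanSpace ℝ (Fin d) → ℝ) :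
    ∫ θ, f (a θ) ∂sphereUniform d = ∫ θ, f θ ∂sphereUniform d :=
  (measurePreserving_sphereUniform a).integral_comp a.toHomeomorph.measurableEmbedding f

theorem integral_inner_sphereUniform (v : EuclideanSpace ℝ (Fin d)) :
    ∫ θ, inner ℝ v θ ∂sphereUniform d = 0 := by
  have h := integral_comp_isometry_sphereUniform (LinearIsometryEquiv.neg ℝ) (inner ℝ v)
  simp only [LinearIsometryEquiv.coe_neg, inner_neg_right, integral_neg] at h
  linarith

/-- The reflection in the hyperplane orthogonal to `v - w` exchanges `v` and `w` and preserves the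
uniform law. -/
theorem integral_inner_sq_sphereUniform_congr {v w : EuclideanSpace ℝ (Fin d)}
    (h : ‖v‖ = ‖w‖) :
    ∫ θ, inner ℝ v θ ^ 2 ∂sphereUniform d = ∫ θ, inner ℝ w θ ^ 2 ∂sphereUniform d := by
  rw [← integral_comp_isometry_sphereUniform (Submodule.reflection (ℝ ∙ (v - w))ᗮ)
    fun θ => inner ℝ w θ ^ 2]
  congr 1 with θ
  have hθ := (Submodule.reflection (ℝ ∙ (v - w))ᗮ).inner_map_map v θ
  rw [Submodule.reflection_sub h] at hθ
  rw [hθ]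

theorem integrable_inner_pow_sphereUniform (hd : 0 < d) (v : EuclideanSpace ℝ (Fin d)) (m : ℕ) :
    Integrable (fun θ => inner ℝ v θ ^ m) (sphereUniform d) := by
  have := isProbabilityMeasure_sphereUniform hd
  refine Integrable.of_bound (by fun_prop) (‖v‖ ^ m) ?_
  filter_upwards [ae_sphereUniform_norm_eq_one] with θ hθ
  rw [norm_pow]
  refine pow_le_pow_left₀ (norm_nonneg _) ?_ m
  simpa [hθ] using norm_inner_le_norm (𝕜 := ℝ) v θ

/-- The integral depends only on `‖v‖`, so `v` may be replaced by `‖v‖` times any basis vector; the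
sum over the basis is `‖v‖²` because `‖θ‖ = 1`. -/
theorem integral_inner_sq_sphereUniform (hd : 0 < d) (v : EuclideanSpace ℝ (Fin d)) :
    ∫ θ, inner ℝ v θ ^ 2 ∂sphereUniform d = ‖v‖ ^ 2 / d := by
  have := isProbabilityMeasure_sphereUniform hd
  have h1 : ∀ i : Fin d, ∫ θ, inner ℝ (‖v‖ • EuclideanSpace.single i (1 : ℝ)) θ ^ 2
      ∂sphereUniform d = ∫ θ, inner ℝ v θ ^ 2 ∂sphereUniform d := fun i =>
    integral_inner_sq_sphereUniform_congr (by simp [norm_smul])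
  have h2 : ∑ i : Fin d, ∫ θ, inner ℝ (‖v‖ • EuclideanSpace.single i (1 : ℝ)) θ ^ 2
      ∂sphereUniform d = ‖v‖ ^ 2 := by
    rw [← integral_finsetSum _ fun i _ => integrable_inner_pow_sphereUniform hd _ 2]
    trans ∫ _, ‖v‖ ^ 2 ∂sphereUniform d
    · refine integral_congr_ae ?_
      filter_upwards [ae_sphereUniform_norm_eq_one] with θ hθ
      have h3 := EuclideanSpace.real_norm_sq_eq θ
      rw [hθ] at h3
      simp [real_inner_smul_left, EuclideanSpace.inner_single_left, mul_pow, ← Finset.mul_sum, ← h3]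
    · simp
  simp_rw [h1] at h2
  have : (0 : ℝ) < d := by exact_mod_cast hd
  rw [← h2]
  simp [this.ne']

theorem integral_norm_add_smul_sq_sphereUniform (hd : 0 < d) (v : EuclideanSpace ℝ (Fin d))
    (x : ℝ) : ∫ θ, ‖v + x • θ‖ ^ 2 ∂sphereUniform d = ‖v‖ ^ 2 + x ^ 2 := by
  have := isProbabilityMeasure_sphereUniform hd
  have h : ∀ᵐ θ ∂sphereUniform d, ‖v + x • θ‖ ^ 2 =
      (‖v‖ ^ 2 + x ^ 2) + 2 * x * inner ℝ v θ := by
    filter_upwards [ae_sphereUniform_norm_eq_one] with θ hθ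
    rw [norm_add_sq_real, real_inner_smul_right, norm_smul, hθ, mul_one, Real.norm_eq_abs, sq_abs]
    ring
  have hi := integrable_inner_pow_sphereUniform hd v 1
  simp only [pow_one] at hi
  rw [integral_congr_ae h, integral_add (integrable_const _) (hi.const_mul _), integral_const_mul,
    integral_inner_sphereUniform]
  simp

theorem integral_norm_add_smul_pow_four_sphereUniform (hd : 0 < d)
    (v : EuclideanSpace ℝ (Fin d)) (x : ℝ) :
    ∫ θ, ‖v + x • θ‖ ^ 4 ∂sphereUniform d =
      ‖v‖ ^ 4 + (2 + 4 / d) * x ^ 2 * ‖v‖ ^ 2 + x ^ 4 := by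
  have := isProbabilityMeasure_sphereUniform hd
  have h : ∀ᵐ θ ∂sphereUniform d, ‖v + x • θ‖ ^ 4 =
      ((‖v‖ ^ 2 + x ^ 2) ^ 2 + 4 * x * (‖v‖ ^ 2 + x ^ 2) * inner ℝ v θ) +
        4 * x ^ 2 * inner ℝ v θ ^ 2 := by
    filter_upwards [ae_sphereUniform_norm_eq_one] with θ hθ
    rw [show ‖v + x • θ‖ ^ 4 = (‖v + x • θ‖ ^ 2) ^ 2 by ring, norm_add_sq_real,
      real_inner_smul_right, norm_smul, hθ, mul_one, Real.norm_eq_abs, sq_abs]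
    ring
  have hi := integrable_inner_pow_sphereUniform hd v 1
  simp only [pow_one] at hi
  have hi' : Integrable (fun θ => (‖v‖ ^ 2 + x ^ 2) ^ 2 +
      4 * x * (‖v‖ ^ 2 + x ^ 2) * inner ℝ v θ) (sphereUniform d) :=
    (integrable_const _).add (hi.const_mul _)
  rw [integral_congr_ae h, integral_add hi'
    ((integrable_inner_pow_sphereUniform hd v 2).const_mul _),
    integral_add (integrable_const _) (hi.const_mul _), integral_const_mul, integral_const_mul,
    integral_inner_sphereUniform, integral_inner_sq_sphereUniform hd]
  simp
  ring

variable {Ω ι : Type*} [MeasurableSpace Ω] {P : Measure Ω}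
  {Θ : ι → Ω → EuclideanSpace ℝ (Fin d)}

theorem ae_norm_sum_smul_le (hΘ : ∀ j, HasLaw (Θ j) (sphereUniform d) P) (x : ι → ℝ)
    (s : Finset ι) : ∀ᵐ ω ∂P, ‖∑ j ∈ s, x j • Θ j ω‖ ≤ ∑ j ∈ s, |x j| := by
  have h : ∀ᵐ ω ∂P, ∀ j ∈ s, ‖Θ j ω‖ = 1 := by
    refine (Finset.eventually_all s).2 fun j _ => ?_
    have h1 := ae_sphereUniform_norm_eq_one (d := d)
    rw [← (hΘ j).map_eq] at h1
    exact ae_of_ae_map (hΘ j).aemeasurable h1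
  filter_upwards [h] with ω hω
  refine (norm_sum_le _ _).trans (Finset.sum_le_sum fun j hj => ?_)
  rw [norm_smul, hω j hj, mul_one, Real.norm_eq_abs]

theorem integrable_norm_pow_sum_smul [IsProbabilityMeasure P]
    (hΘ : ∀ j, HasLaw (Θ j) (sphereUniform d) P) (x : ι → ℝ)
    (s : Finset ι) (m : ℕ) : Integrable (fun ω => ‖∑ j ∈ s, x j • Θ j ω‖ ^ m) P := by
  have hm : ∀ j, AEMeasurable (Θ j) P := fun j => (hΘ j).aemeasurable
  refine Integrable.of_bound (C := (∑ j ∈ s, |x j|) ^ m) ?_ ?_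
  · exact AEMeasurable.aestronglyMeasurable (by fun_prop)
  · filter_upwards [ae_norm_sum_smul_le hΘ x s] with ω hω
    rw [Real.norm_of_nonneg (by positivity)]
    gcongr

/-- The new vector is independent of the partial sum, so Fubini integrates it out first; this is the
induction step for both moments. -/
theorem integral_norm_pow_sum_insert [DecidableEq ι] [IsProbabilityMeasure P]
    (hΘ : ∀ j, HasLaw (Θ j) (sphereUniform d) P) (hindep : iIndepFun Θ P)
    (x : ι → ℝ) {s : Finset ι} {j : ι} (hj : j ∉ s) (m : ℕ) :
    ∫ ω, ‖∑ i ∈ insert j s, x i • Θ i ω‖ ^ m ∂P =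
      ∫ ω, ∫ θ, ‖(∑ i ∈ s, x i • Θ i ω) + x j • θ‖ ^ m ∂sphereUniform d ∂P := by
  have hm : ∀ j, AEMeasurable (Θ j) P := fun j => (hΘ j).aemeasurable
  have : IsProbabilityMeasure (sphereUniform d) :=
    (hΘ j).isProbabilityMeasure_iff.1 inferInstance
  set S : Ω → EuclideanSpace ℝ (Fin d) := fun ω => ∑ i ∈ s, x i • Θ i ω with hS
  have hSm : AEMeasurable S P := by fun_prop
  have hind : IndepFun S (Θ j) P := by
    have h := hindep.indepFun_finset₀ s {j} (by simpa using hj) hm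
    have hφ : Measurable fun p : s → EuclideanSpace ℝ (Fin d) => ∑ i : s, x i • p i := by fun_prop
    have hψ : Measurable fun p : ({j} : Finset ι) → EuclideanSpace ℝ (Fin d) =>
        p ⟨j, Finset.mem_singleton_self j⟩ := measurable_pi_apply _
    have h2 := h.comp hφ hψ
    convert h2 using 1
    · ext1 ω
      exact (Finset.sum_coe_sort s fun i => x i • Θ i ω).symm
    · rfl
  have hlaw := hind.hasLaw_prod ⟨hSm, rfl⟩ (hΘ j)
  have hmeas : Measurable fun p : EuclideanSpace ℝ (Fin d) × EuclideanSpace ℝ (Fin d) =>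
      ‖p.1 + x j • p.2‖ ^ m := by fun_prop
  have hint := integrable_norm_pow_sum_smul hΘ x (insert j s) m
  have heq : (fun ω => ‖∑ i ∈ insert j s, x i • Θ i ω‖ ^ m) =
      (fun p : EuclideanSpace ℝ (Fin d) × EuclideanSpace ℝ (Fin d) => ‖p.1 + x j • p.2‖ ^ m) ∘
        fun ω => (S ω, Θ j ω) := by
    ext ω
    simp [hS, Finset.sum_insert hj, add_comm]
  rw [heq] at hint ⊢
  rw [hlaw.integral_comp hmeas.aestronglyMeasurable, integral_prod]
  · exact integral_map hSm hmeas.stronglyMeasurable.integral_prod_right.aestronglyMeasurable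
  · rw [← hlaw.map_eq]
    exact (integrable_map_measure hmeas.aestronglyMeasurable hlaw.aemeasurable).2 hint

theorem integral_norm_sq_sum_smul [IsProbabilityMeasure P] (hd : 0 < d)
    (hΘ : ∀ j, HasLaw (Θ j) (sphereUniform d) P) (hindep : iIndepFun Θ P)
    (x : ι → ℝ) (s : Finset ι) :
    ∫ ω, ‖∑ i ∈ s, x i • Θ i ω‖ ^ 2 ∂P = ∑ i ∈ s, x i ^ 2 := by
  classical
  induction s using Finset.induction_on with
  | empty => simp
  | insert j s hj ih =>
    rw [integral_norm_pow_sum_insert hΘ hindep x hj]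
    simp_rw [integral_norm_add_smul_sq_sphereUniform hd]
    rw [integral_add (integrable_norm_pow_sum_smul hΘ x s 2) (integrable_const _), ih,
      Finset.sum_insert hj]
    simp [add_comm]

theorem integral_norm_pow_four_sum_smul [IsProbabilityMeasure P] (hd : 0 < d)
    (hΘ : ∀ j, HasLaw (Θ j) (sphereUniform d) P) (hindep : iIndepFun Θ P)
    (x : ι → ℝ) (s : Finset ι) :
    ∫ ω, ‖∑ i ∈ s, x i • Θ i ω‖ ^ 4 ∂P =
      (1 + 2 / d) * (∑ i ∈ s, x i ^ 2) ^ 2 - 2 / d * ∑ i ∈ s, x i ^ 4 := by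
  classical
  induction s using Finset.induction_on with
  | empty => simp
  | insert j s hj ih =>
    rw [integral_norm_pow_sum_insert hΘ hindep x hj]
    simp_rw [integral_norm_add_smul_pow_four_sphereUniform hd]
    have h2 := integrable_norm_pow_sum_smul hΘ x s 2
    have h4 := integrable_norm_pow_sum_smul hΘ x s 4
    have h42 : Integrable (fun ω => ‖∑ i ∈ s, x i • Θ i ω‖ ^ 4 +
        (2 + 4 / d) * x j ^ 2 * ‖∑ i ∈ s, x i • Θ i ω‖ ^ 2) P := h4.add (h2.const_mul _)
    rw [integral_add h42 (integrable_const _),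
      integral_add h4 (h2.const_mul _), integral_const_mul, ih,
      integral_norm_sq_sum_smul hd hΘ hindep, Finset.sum_insert hj, Finset.sum_insert hj]
    simp
    ring

end Sphere

/-! ### Moments of the beta distribution -/

theorem integral_betaPDFReal {a b : ℝ} (ha : 0 < a) (hb : 0 < b) :
    ∫ z, betaPDFReal a b z = 1 := by
  rw [integral_eq_lintegral_of_nonneg_ae _ (by fun_prop)]
  · exact (congrArg ENNReal.toReal (lintegral_betaPDF_eq_one ha hb)).trans ENNReal.toReal_one
  · refine Filter.Eventually.of_forall fun z => ?_
    by_cases hz : 0 < z ∧ z < 1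
    · exact (betaPDFReal_pos hz.1 hz.2 ha hb).le
    · simp [betaPDFReal, if_neg hz]

/-- Multiplying the density by `zᵐ` gives a multiple of the beta density with parameters `a + m` and
`b`, whose integral is `1`. -/
theorem integral_pow_betaMeasure {a b : ℝ} (ha : 0 < a) (hb : 0 < b) (m : ℕ) :
    ∫ z, z ^ m ∂betaMeasure a b =
      (ascPochhammer ℝ m).eval a / (ascPochhammer ℝ m).eval (a + b) := by
  have hG := Real.Gamma_pos_of_pos ha
  have hGb := Real.Gamma_pos_of_pos hb
  have hGab := Real.Gamma_pos_of_pos (add_pos ha hb)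
  have hPa := ascPochhammer_pos m a ha
  have hPab := ascPochhammer_pos m (a + b) (add_pos ha hb)
  rw [betaMeasure, integral_withDensity_eq_integral_toReal_smul (by unfold betaPDF; fun_prop)
    (Filter.Eventually.of_forall fun y => by simp [betaPDF])]
  have h : ∀ z : ℝ, (betaPDF a b z).toReal • z ^ m =
      ((ascPochhammer ℝ m).eval a / (ascPochhammer ℝ m).eval (a + b)) *
        betaPDFReal (a + m) b z := by
    intro z
    by_cases hz : 0 < z ∧ z < 1
    · rw [betaPDF, ENNReal.toReal_ofReal (betaPDFReal_pos hz.1 hz.2 ha hb).le, betaPDFReal,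
        betaPDFReal, if_pos hz, if_pos hz, beta, beta, Real.Gamma_add_natCast ha,
        show a + m + b = a + b + m by ring, Real.Gamma_add_natCast (add_pos ha hb),
        show a + m - 1 = a - 1 + m by ring, Real.rpow_add hz.1, Real.rpow_natCast, smul_eq_mul]
      field_simp
    · simp [betaPDF, betaPDFReal, if_neg hz]
  simp_rw [h]
  rw [integral_const_mul, integral_betaPDFReal (by positivity) hb, mul_one]

/-! ### Moments of sums of powers under the symmetric Dirichlet law -/

section SymmetricDirichlet

variable {n : ℕ} {q : ℝ}

theorem ascPochhammer_eval_two (x : ℝ) : (ascPochhammer ℝ 2).eval x = x * (x + 1) := by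
  simp [ascPochhammer_succ_eval, ← one_add_one_eq_two]

theorem ascPochhammer_eval_four (x : ℝ) :
    (ascPochhammer ℝ 4).eval x = x * (x + 1) * (x + 2) * (x + 3) := by
  rw [show 4 = 2 + 1 + 1 from rfl, ascPochhammer_succ_eval, ascPochhammer_succ_eval,
    ascPochhammer_eval_two]
  norm_num

theorem integral_pow_dirichletMeasure (hn : 0 < n) (hq : 0 < q) (i : Fin n) (m : ℕ) :
    ∫ x, x i ^ m ∂dirichletMeasure (fun _ : Fin n => q) =
      (ascPochhammer ℝ m).eval q / (ascPochhammer ℝ m).eval (n * q) := by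
  have h := integral_monomial_dirichletMeasure hn (fun _ => hq) (Pi.single i m)
  have h1 : ∀ k : Fin n, (ascPochhammer ℝ ((Pi.single i m : Fin n → ℕ) k)).eval q =
      if k = i then (ascPochhammer ℝ m).eval q else 1 := by
    intro k
    rcases eq_or_ne k i with rfl | hk <;> simp [*]
  simp_rw [h1] at h
  simpa [Pi.single_apply, pow_ite] using h

theorem prod_pow_single_two_add_single_two (x : Fin n → ℝ) (i j : Fin n) :
    ∏ k, x k ^ (Pi.single i 2 + Pi.single j 2 : Fin n → ℕ) k = x i ^ 2 * x j ^ 2 := by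
  simp_rw [Pi.add_apply, pow_add]
  rw [Finset.prod_mul_distrib]
  simp [Pi.single_apply, pow_ite]

theorem integral_sq_mul_sq_dirichletMeasure (hn : 0 < n) (hq : 0 < q) {i j : Fin n}
    (hij : i ≠ j) :
    ∫ x, x i ^ 2 * x j ^ 2 ∂dirichletMeasure (fun _ : Fin n => q) =
      (ascPochhammer ℝ 2).eval q ^ 2 / (ascPochhammer ℝ 4).eval (n * q) := by
  have h := integral_monomial_dirichletMeasure hn (fun _ => hq) (Pi.single i 2 + Pi.single j 2)
  have h1 : ∀ k : Fin n,
      (ascPochhammer ℝ ((Pi.single i 2 + Pi.single j 2 : Fin n → ℕ) k)).eval q =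
      (if k = i then (ascPochhammer ℝ 2).eval q else 1) *
        if k = j then (ascPochhammer ℝ 2).eval q else 1 := by
    intro k
    rcases eq_or_ne k i with rfl | hk
    · simp [hij]
    · rcases eq_or_ne k j with rfl | hk' <;> simp [*]
  simp_rw [h1, prod_pow_single_two_add_single_two] at h
  rw [Finset.prod_mul_distrib] at h
  simpa [Finset.sum_add_distrib, ← sq] using h

theorem integrable_sq_mul_sq_dirichletMeasure (hn : 0 < n) (hq : 0 < q) (i j : Fin n) :
    Integrable (fun x => x i ^ 2 * x j ^ 2) (dirichletMeasure fun _ : Fin n => q) := by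
  have h := integrable_monomial_dirichletMeasure hn (fun _ => hq) (Pi.single i 2 + Pi.single j 2)
  simpa only [prod_pow_single_two_add_single_two] using h

theorem integrable_pow_dirichletMeasure (hn : 0 < n) (hq : 0 < q) (i : Fin n) (m : ℕ) :
    Integrable (fun x => x i ^ m) (dirichletMeasure fun _ : Fin n => q) := by
  have h := integrable_monomial_dirichletMeasure hn (fun _ => hq) (Pi.single i m)
  simpa [Pi.single_apply, pow_ite] using h

theorem integral_sum_pow_dirichletMeasure (hn : 0 < n) (hq : 0 < q) (m : ℕ) :
    ∫ x, ∑ i, x i ^ m ∂dirichletMeasure (fun _ : Fin n => q) =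
      n * (ascPochhammer ℝ m).eval q / (ascPochhammer ℝ m).eval (n * q) := by
  rw [integral_finsetSum _ fun i _ => integrable_pow_dirichletMeasure hn hq i m]
  simp [integral_pow_dirichletMeasure hn hq, mul_div_assoc]

theorem integrable_sum_sq_sq_dirichletMeasure (hn : 0 < n) (hq : 0 < q) :
    Integrable (fun x => (∑ i, x i ^ 2) ^ 2) (dirichletMeasure fun _ : Fin n => q) := by
  simp_rw [sq (∑ i, _), Finset.sum_mul_sum]
  exact integrable_finsetSum _ fun i _ => integrable_finsetSum _ fun j _ =>
    integrable_sq_mul_sq_dirichletMeasure hn hq i j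

theorem integral_sum_sq_sq_dirichletMeasure (hn : 0 < n) (hq : 0 < q) :
    ∫ x, (∑ i, x i ^ 2) ^ 2 ∂dirichletMeasure (fun _ : Fin n => q) =
      (n * (ascPochhammer ℝ 4).eval q + n * (n - 1) * (ascPochhammer ℝ 2).eval q ^ 2) /
        (ascPochhammer ℝ 4).eval (n * q) := by
  have hI := integrable_sq_mul_sq_dirichletMeasure (n := n) hn hq
  simp_rw [sq (∑ i, _), Finset.sum_mul_sum]
  rw [integral_finsetSum _ fun i _ => integrable_finsetSum _ fun j _ => hI i j]
  simp_rw [fun i => integral_finsetSum Finset.univ fun j _ => hI i j]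
  -- Off-diagonal value everywhere plus a correction on the diagonal, so that the double sum is
  -- immediate.
  have h : ∀ i j : Fin n, ∫ x, x i ^ 2 * x j ^ 2 ∂dirichletMeasure (fun _ : Fin n => q) =
      (ascPochhammer ℝ 2).eval q ^ 2 / (ascPochhammer ℝ 4).eval (n * q) +
        if i = j then ((ascPochhammer ℝ 4).eval q - (ascPochhammer ℝ 2).eval q ^ 2) /
          (ascPochhammer ℝ 4).eval (n * q) else 0 := by
    intro i j
    rcases eq_or_ne i j with rfl | hij
    · simp_rw [← pow_add, integral_pow_dirichletMeasure hn hq]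
      simp
      ring
    · simp [integral_sq_mul_sq_dirichletMeasure hn hq hij, hij]
  simp_rw [h, Finset.sum_add_distrib]
  simp
  ring

end SymmetricDirichlet

/-! ### Comparison of the moments -/

section Main

variable {Ω : Type*} [MeasurableSpace Ω] {P : Measure Ω} {n d : ℕ}
  {X : Ω → Fin n → ℝ} {Θ : Fin n → Ω → EuclideanSpace ℝ (Fin d)}

theorem integral_norm_pow_sum_smul_of_indepFun [IsProbabilityMeasure P]
    {μ : Measure (Fin n → ℝ)} (hX : HasLaw X μ P)
    (hΘ : ∀ j, HasLaw (Θ j) (sphereUniform d) P) (hΘ_indep : iIndepFun Θ P)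
    (hXΘ : IndepFun X (fun ω j => Θ j ω) P) (m : ℕ)
    (hint : Integrable (fun ω => ‖∑ j, X ω j • Θ j ω‖ ^ m) P) :
    ∫ ω, ‖∑ j, X ω j • Θ j ω‖ ^ m ∂P = ∫ x, ∫ ω, ‖∑ j, x j • Θ j ω‖ ^ m ∂P ∂μ := by
  have : IsProbabilityMeasure μ := hX.isProbabilityMeasure_iff.1 inferInstance
  have : ∀ _ : Fin n, IsProbabilityMeasure (sphereUniform d) := fun j =>
    (hΘ j).isProbabilityMeasure_iff.1 inferInstance
  have hpi := hΘ_indep.hasLaw_pi hΘ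
  have hlaw := hXΘ.hasLaw_prod hX hpi
  have hmeas : Measurable fun p : (Fin n → ℝ) × (Fin n → EuclideanSpace ℝ (Fin d)) =>
      ‖∑ j, p.1 j • p.2 j‖ ^ m := by fun_prop
  have hint' : Integrable (fun p : (Fin n → ℝ) × (Fin n → EuclideanSpace ℝ (Fin d)) =>
      ‖∑ j, p.1 j • p.2 j‖ ^ m) (μ.prod (Measure.pi fun _ => sphereUniform d)) := by
    rw [← hlaw.map_eq]
    exact (integrable_map_measure hmeas.aestronglyMeasurable hlaw.aemeasurable).2 hint
  have h := hlaw.integral_comp hmeas.aestronglyMeasurable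
  rw [Function.comp_def] at h
  rw [h, integral_prod _ hint']
  congr 1 with x
  exact (hpi.integral_comp (f := fun θ => ‖∑ j, x j • θ j‖ ^ m)
    (Measurable.aestronglyMeasurable (by fun_prop))).symm

theorem IsHyperuniform.integrable_norm_pow [IsProbabilityMeasure P]
    {U : Ω → EuclideanSpace ℝ (Fin d)} {k : ℝ}
    (hU : IsHyperuniform U k P) (m : ℕ) : Integrable (fun ω => ‖U ω‖ ^ m) P := by
  -- Rotation invariance at the identity already contains the measurability of `U`.
  have hm : AEMeasurable U P :=
    (hU.rotation_invariant (LinearIsometryEquiv.refl ℝ _)).aemeasurable_snd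
  refine Integrable.of_bound (hm.norm.pow_const m).aestronglyMeasurable 1 ?_
  filter_upwards [hU.mem_ball] with ω hω
  rw [Real.norm_of_nonneg (by positivity)]
  exact pow_le_one₀ (norm_nonneg _) hω

theorem IsHyperuniform.integral_norm_pow (hd : 0 < d) {U : Ω → EuclideanSpace ℝ (Fin d)} {k : ℝ}
    (hU : IsHyperuniform U k P) (m : ℕ) :
    ∫ ω, ‖U ω‖ ^ (2 * m) ∂P =
      (ascPochhammer ℝ m).eval (d / 2 : ℝ) / (ascPochhammer ℝ m).eval (k / 2) := by
  have hd' : (0 : ℝ) < d := by exact_mod_cast hd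
  have hk := hU.lt_type
  have h := hU.norm_sq_law.integral_comp (f := fun z => z ^ m)
    (Measurable.aestronglyMeasurable (by fun_prop))
  simp only [Function.comp_def, ← pow_mul] at h
  rw [h, integral_pow_betaMeasure (by positivity) (by linarith)]
  congr 2
  ring

theorem eq_or_eq_of_moment_identities {n d q k : ℝ} (hn : 1 < n) (hd : 0 < d) (hq : 0 < q)
    (hk : 0 < k) (h2 : (q + 1) * k = d * (n * q + 1))
    (h4 : (n * (q * (q + 1) * (q + 2) * (q + 3)) + n * (n - 1) * (1 + 2 / d) * (q * (q + 1)) ^ 2) *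
      (k * (k + 2)) = d * (d + 2) * (n * q * (n * q + 1) * (n * q + 2) * (n * q + 3))) :
    q = d - 1 ∨ q = d / 2 - 1 := by
  have hk' : k = d * (n * q + 1) / (q + 1) := by
    field_simp
    linarith
  subst hk'
  field_simp at h4
  have h : (d - (q + 1)) * (d - 2 * (q + 1)) = 0 := by
    -- With `k` eliminated and denominators cleared, the fourth moment identity is this nonzero
    -- factor times the product in the goal.
    have hc : 2 * (n - 1) * q ≠ 0 := by
      have : 0 < n - 1 := by linarith
      positivity
    refine (mul_eq_zero.1 ?_).resolve_left hc
    linear_combination h4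
  rcases mul_eq_zero.1 h with h | h
  · left; linarith
  · right; linarith

end Main

theorem theorem9 {Ω : Type*} [MeasurableSpace Ω] (P : Measure Ω) [IsProbabilityMeasure P]
    (n d : ℕ) (hn : 1 ≤ n) (hd : 1 ≤ d) (q k : ℝ) (hq : 0 < q)
    (X : Ω → Fin n → ℝ) (Θ : Fin n → Ω → EuclideanSpace ℝ (Fin d))
    (hX : HasLaw X (dirichletMeasure fun _ : Fin n => q) P)
    (hΘ : ∀ j, HasLaw (Θ j) (sphereUniform d) P)
    (hΘ_indep : iIndepFun Θ P)
    (hXΘ : IndepFun X (fun ω j => Θ j ω) P)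
    (hW : IsHyperuniform (fun ω => ∑ j, X ω j • Θ j ω) k P) :
    (2 ≤ d ∧ q = d - 1 ∧ 2 ≤ n ∧ k = n * ((d : ℝ) - 1) + 1) ∨
      (3 ≤ d ∧ q = (d : ℝ) / 2 - 1 ∧ 2 ≤ n ∧ k = n * ((d : ℝ) - 2) + 2) := by
  have hd' : (0 : ℝ) < d := by exact_mod_cast hd
  have hn' : (0 : ℝ) < n := by exact_mod_cast hn
  have hdk := hW.lt_type
  have hk : 0 < k := hd'.trans hdk
  have hnq : 0 < n * q := by positivity
  have h2 : (q + 1) * k = d * (n * q + 1) := by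
    have h := hW.integral_norm_pow hd 1
    rw [mul_one, integral_norm_pow_sum_smul_of_indepFun hX hΘ hΘ_indep hXΘ 2
      (hW.integrable_norm_pow 2)] at h
    simp_rw [integral_norm_sq_sum_smul hd hΘ hΘ_indep] at h
    rw [integral_sum_pow_dirichletMeasure hn hq, ascPochhammer_eval_two, ascPochhammer_eval_two,
      ascPochhammer_one, Polynomial.eval_X, Polynomial.eval_X] at h
    field_simp at h
    linarith
  have h4 : (n * (q * (q + 1) * (q + 2) * (q + 3)) +
      n * (n - 1) * (1 + 2 / d) * (q * (q + 1)) ^ 2) * (k * (k + 2)) =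
      d * (d + 2) * (n * q * (n * q + 1) * (n * q + 2) * (n * q + 3)) := by
    have h := hW.integral_norm_pow hd 2
    rw [integral_norm_pow_sum_smul_of_indepFun hX hΘ hΘ_indep hXΘ _
      (hW.integrable_norm_pow _)] at h
    simp_rw [show 2 * 2 = 4 from rfl, integral_norm_pow_four_sum_smul hd hΘ hΘ_indep] at h
    rw [integral_sub ((integrable_sum_sq_sq_dirichletMeasure hn hq).const_mul _)
      ((integrable_finsetSum _ fun i _ => integrable_pow_dirichletMeasure hn hq i 4).const_mul _),
      integral_const_mul, integral_const_mul, integral_sum_sq_sq_dirichletMeasure hn hq,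
      integral_sum_pow_dirichletMeasure hn hq, ascPochhammer_eval_four, ascPochhammer_eval_four,
      ascPochhammer_eval_two, ascPochhammer_eval_two, ascPochhammer_eval_two] at h
    field_simp at h ⊢
    linear_combination h
  -- For `n = 1` the second moment identity reads `(q + 1) * k = d * (q + 1)`, so `k = d`, against
  -- `d < k`.
  have hn2 : 2 ≤ n := by
    by_contra hlt
    obtain rfl : n = 1 := by omega
    rw [Nat.cast_one, one_mul, mul_comm] at h2
    exact hdk.ne (mul_right_cancel₀ (by positivity) h2).symm
  rcases eq_or_eq_of_moment_identities (by exact_mod_cast hn2) hd' hq hk h2 h4 with h | h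
  · left
    -- From `q = d - 1 > 0`.
    have h1d : (1 : ℝ) < d := by linarith
    refine ⟨by exact_mod_cast h1d, h, hn2, ?_⟩
    rw [h] at h2
    apply mul_left_cancel₀ hd'.ne'
    linarith
  · right
    -- From `q = d / 2 - 1 > 0`.
    have h2d : (2 : ℝ) < d := by linarith
    refine ⟨by exact_mod_cast h2d, h, hn2, ?_⟩
    rw [h] at h2
    apply mul_left_cancel₀ hd'.ne'
    linarith
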